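/- Let $m\in\mathbb{N}_0$, let $X$ be a complex Banach space, and let $\mathcal{P}(^mX)$ be the space of all functions $p:X\to\mathbb{C}$ of the form $p(x)=L(x,\dots,x)$ with $L:X^m\to\mathbb{C}$ continuous and $m$-linear. Write $\mathcal{P}(^mX)_{\tau_0}$ for this space endowed with the topology of uniform convergence on the compact subsets of $X$. Let $\varphi:X\to X$ be a continuous linear mapping, and let $C_\varphi:\mathcal{P}(^mX)_{\tau_0}\to\mathcal{P}(^mX)_{\tau_0}$, $C_\varphi(p)=p\circ\varphi$, be the (continuous linear) composition operator with symbol $\varphi$. If $C_\varphi$ is power bounded, i.e. the sequence $(C_\varphi^n)_{n\in\mathbb{N}}$ of its iterates is equicontinuous, then $C_\varphi$ is uniformly mean ergodic, i.e. there is a continuous linear operator $S:\mathcal{P}(^mX)_{\tau_0}\to\mathcal{P}(^mX)_{\tau_0}$ such that the Cesàro means $$\frac1n\sum_{k=0}^{n-1}C_\varphi^k$$ converge to $S$, as $n\to\infty$, uniformly on the bounded subsets of $\mathcal{P}(^mX)_{\tau_0}$. -/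

import Mathlib

open Filter Topology

/-- The space `𝒫(ᵐX)` of (continuous) `m`-homogeneous polynomials on `X`: the functions of the form
`x ↦ L (x, …, x)` with `L` a continuous `m`-linear form on `X`. It is a subspace of `C(X, ℂ)` and
carries the topology (and uniform structure) induced by `C(X, ℂ)`, which in Mathlib is the
compact-open topology `τ₀`, i.e. the topology of uniform convergence on compact sets. -/
def HomPoly (m : ℕ) (X : Type*) [NormedAddCommGroup X] [NormedSpace ℂ X] :
    Submodule ℂ C(X, ℂ) where
  carrier := {p | ∃ L : ContinuousMultilinearMap ℂ (fun _ : Fin m => X) ℂ,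
    ∀ x : X, p x = L (fun _ => x)}
  add_mem' := by
    rintro p q ⟨L, hL⟩ ⟨M, hM⟩
    exact ⟨L + M, fun x => by simp [hL, hM]⟩
  zero_mem' := ⟨0, fun x => by simp⟩
  smul_mem' := by
    rintro c p ⟨L, hL⟩
    exact ⟨c • L, fun x => by simp [hL]⟩

/-- The uniform structure of uniform convergence on compact sets on `𝒫(ᵐX)` is the one of its
additive topological group structure. -/
instance HomPoly.instIsUniformAddGroup (m : ℕ) (X : Type*) [NormedAddCommGroup X] [NormedSpace ℂ X] :
    IsUniformAddGroup (HomPoly m X) := by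
  have h : IsUniformAddGroup C(X, ℂ) :=
    IsUniformInducing.isUniformAddGroup
      ({ toFun := ContinuousMap.toUniformOnFunIsCompact
         map_zero' := rfl
         map_add' := fun _ _ => rfl } : C(X, ℂ) →+ UniformOnFun X ℂ {K | IsCompact K})
      ContinuousMap.isUniformEmbedding_toUniformOnFunIsCompact.isUniformInducing
  exact (HomPoly m X).toAddSubgroup.isUniformAddGroup

/-- The composition operator `C_φ : 𝒫(ᵐX)_{τ₀} → 𝒫(ᵐX)_{τ₀}`, `C_φ(p) = p ∘ φ`, whose symbol
`φ : X → X` is a continuous linear map. -/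
noncomputable def compOp (m : ℕ) {X : Type*} [NormedAddCommGroup X] [NormedSpace ℂ X] (φ : X →L[ℂ] X) :
    HomPoly m X →L[ℂ] HomPoly m X where
  toFun p := ⟨p.1.comp (φ : C(X, X)), by
    obtain ⟨L, hL⟩ := p.2
    exact ⟨L.compContinuousLinearMap (fun _ => φ), fun x => by simp [hL]⟩⟩
  map_add' _ _ := rfl
  map_smul' _ _ := rfl
  cont := ((ContinuousMap.continuous_precomp (φ : C(X, X))).comp
    continuous_subtype_val).subtype_mk _

/-- `T ∈ L(E)` is power bounded if the sequence `(Tⁿ)` of its iterates is equicontinuous. -/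
def IsPowerBounded {E : Type*} [AddCommGroup E] [Module ℂ E] [UniformSpace E]
    [IsUniformAddGroup E] (T : E →L[ℂ] E) : Prop :=
  Equicontinuous (fun n : ℕ => (⇑(T ^ n) : E → E))

/-- The Cesàro means `T_[n] = (1/n) ∑_{k=0}^{n-1} T^k`; only `n ≥ 1` matters. -/
noncomputable def cesaroMean {E : Type*} [AddCommGroup E] [Module ℂ E] [TopologicalSpace E]
    [IsTopologicalAddGroup E] [ContinuousSMul ℂ E] (T : E →L[ℂ] E) (n : ℕ) : E →L[ℂ] E :=
  (n : ℂ)⁻¹ • ∑ k ∈ Finset.range n, T ^ k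

/-- `T ∈ L(E)` is uniformly mean ergodic if its Cesàro means converge to some `S ∈ L(E)` uniformly
on the bounded subsets of `E` (this is Mathlib's topology on `E →L[ℂ] E`). -/
def IsUniformlyMeanErgodic {E : Type*} [AddCommGroup E] [Module ℂ E] [TopologicalSpace E]
    [IsTopologicalAddGroup E] [ContinuousSMul ℂ E] (T : E →L[ℂ] E) : Prop :=
  ∃ S : E →L[ℂ] E, Tendsto (fun n : ℕ => cesaroMean T n) atTop (𝓝 S)

/-! Everything rests on `𝒫(ᵐX)_{τ₀}` being semi-Montel: every bounded set lies in a compact one. By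
Baire, a pointwise bounded family of polynomials satisfies a common bound `‖p x‖ ≤ C * ‖x‖ ^ m`
(`HomPoly.exists_forall_norm_le`). The polynomials obeying this bound are equicontinuous by the
Schwarz lemma and pointwise closed by polarization, so Tychonoff and Ascoli make them compact
(`HomPoly.isCompact_setOf_norm_le`).

On a semi-Montel space power boundedness suffices. Cesàro orbits are bounded, hence have cluster
points, and Yosida's argument shows that a cluster point is the limit. Since the means are
equicontinuous, they converge uniformly on compact sets, hence on bounded ones. -/

/-! ### Mean ergodic theory of power bounded operators -/

section MeanErgodic

variable {E : Type*} [AddCommGroup E] [Module ℂ E] [UniformSpace E] [IsUniformAddGroup E]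
  [ContinuousSMul ℂ E]

theorem cesaroMean_apply (T : E →L[ℂ] E) (n : ℕ) (x : E) :
    cesaroMean T n x = (n : ℂ)⁻¹ • ∑ k ∈ Finset.range n, (T ^ k) x := by
  simp [cesaroMean]

theorem cesaroMean_sub_apply (T : E →L[ℂ] E) (n : ℕ) (x : E) :
    cesaroMean T n (x - T x) = (n : ℂ)⁻¹ • (x - (T ^ n) x) := by
  rw [cesaroMean_apply]
  congr 1
  have h := Finset.sum_range_sub' (fun k => (T ^ k) x) n
  simp only [pow_zero, one_apply_eq_self] at h
  rw [← h]
  refine Finset.sum_congr rfl fun k _ => ?_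
  rw [map_sub, pow_succ]
  rfl

theorem cesaroMean_apply_of_fixed {T : E →L[ℂ] E} {y : E} (hy : T y = y) {n : ℕ} (hn : n ≠ 0) :
    cesaroMean T n y = y := by
  have h : ∀ k : ℕ, (T ^ k) y = y := fun k => by
    induction k with
    | zero => rfl
    | succ k ih => rw [pow_succ, mul_apply_eq_comp, hy, ih]
  rw [cesaroMean_apply, Finset.sum_congr rfl fun k _ => h k, Finset.sum_const, Finset.card_range,
    ← Nat.cast_smul_eq_nsmul ℂ, smul_smul, inv_mul_cancel₀ (by exact_mod_cast hn), one_smul]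

theorem cesaroMean_comm (T : E →L[ℂ] E) (n : ℕ) (x : E) :
    T (cesaroMean T n x) = cesaroMean T n (T x) := by
  simp only [cesaroMean_apply, map_smul, map_sum]
  congr 1
  refine Finset.sum_congr rfl fun k _ => ?_
  rw [← mul_apply_eq_comp, ← mul_apply_eq_comp, ← pow_succ, ← pow_succ']

theorem sub_cesaroMean_mem_range (T : E →L[ℂ] E) {n : ℕ} (hn : n ≠ 0) (x : E) :
    x - cesaroMean T n x ∈ LinearMap.range ((1 - T : E →L[ℂ] E) : E →ₗ[ℂ] E) := by
  have h : ∀ k : ℕ, x - (T ^ k) x ∈ LinearMap.range ((1 - T : E →L[ℂ] E) : E →ₗ[ℂ] E) := by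
    intro k
    induction k with
    | zero => simp
    | succ k ih =>
      have : x - (T ^ (k + 1)) x = (x - (T ^ k) x) + (1 - T) ((T ^ k) x) := by
        rw [pow_succ']; simp
      rw [this]
      exact Submodule.add_mem _ ih ⟨_, rfl⟩
  have h2 : x - cesaroMean T n x = (n : ℂ)⁻¹ • ∑ k ∈ Finset.range n, (x - (T ^ k) x) := by
    rw [cesaroMean_apply, Finset.sum_sub_distrib, smul_sub, Finset.sum_const, Finset.card_range,
      ← Nat.cast_smul_eq_nsmul ℂ, smul_smul, inv_mul_cancel₀ (by exact_mod_cast hn), one_smul]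
  rw [h2]
  exact Submodule.smul_mem _ _ (Submodule.sum_mem _ fun k _ => h k)

variable [PolynormableSpace ℂ E] {T : E →L[ℂ] E}

theorem IsPowerBounded.exists_seminorm (hT : IsPowerBounded T) {q : Seminorm ℂ E}
    (hq : Continuous q) :
    ∃ p : Seminorm ℂ E, Continuous p ∧ ∀ n x, q ((T ^ n) x) ≤ p x := by
  have htfae := ((PolynormableSpace.withSeminorms ℂ E).equicontinuous_TFAE
    (fun n : ℕ => ((T ^ n : E →L[ℂ] E) : E →ₗ[ℂ] E))).out 1 3
  obtain ⟨p, hp, h⟩ := htfae.mp hT ⟨q, hq⟩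
  exact ⟨p, hp, fun n x => h n x⟩

omit [PolynormableSpace ℂ E] in
theorem seminorm_cesaroMean_le {p q : Seminorm ℂ E} (h : ∀ n x, q ((T ^ n) x) ≤ p x)
    (n : ℕ) (x : E) : q (cesaroMean T n x) ≤ p x := by
  -- For `n = 0` the mean is `0`, because `0⁻¹ = 0`.
  rcases eq_or_ne n 0 with rfl | hn
  · simp [cesaroMean_apply]
  have hn' : (0 : ℝ) < n := by exact_mod_cast hn.bot_lt
  rw [cesaroMean_apply, map_smul_eq_mul, norm_inv, Complex.norm_natCast, inv_mul_le_iff₀ hn']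
  calc q (∑ k ∈ Finset.range n, (T ^ k) x) ≤ ∑ k ∈ Finset.range n, q ((T ^ k) x) :=
        Finset.le_sum_of_subadditive q (map_zero q).le (map_add_le_add q) _ _
    _ ≤ ∑ k ∈ Finset.range n, p x := Finset.sum_le_sum fun k _ => h k x
    _ = n * p x := by simp

theorem IsPowerBounded.equicontinuous_cesaroMean (hT : IsPowerBounded T) :
    Equicontinuous fun n : ℕ => (cesaroMean T n : E → E) := by
  refine (((PolynormableSpace.withSeminorms ℂ E).equicontinuous_TFAE
    (fun n : ℕ => (cesaroMean T n : E →ₗ[ℂ] E))).out 1 3).mpr fun q => ?_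
  obtain ⟨p, hp, h⟩ := hT.exists_seminorm q.2
  exact ⟨p, hp, fun n x => seminorm_cesaroMean_le h n x⟩

theorem IsPowerBounded.tendsto_cesaroMean_sub (hT : IsPowerBounded T) (x : E) :
    Tendsto (fun n => cesaroMean T n (x - T x)) atTop (𝓝 0) := by
  rw [(PolynormableSpace.withSeminorms ℂ E).tendsto_nhds _ _]
  intro q ε hε
  obtain ⟨p, hp, h⟩ := hT.exists_seminorm q.2
  have hlim : Tendsto (fun n : ℕ => (n : ℝ)⁻¹ * (q.1 x + p x)) atTop (𝓝 0) := by
    simpa using (tendsto_inv_atTop_nhds_zero_nat (𝕜 := ℝ)).mul_const (q.1 x + p x)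
  filter_upwards [hlim.eventually_lt_const hε] with n hn
  refine lt_of_le_of_lt ?_ hn
  rw [sub_zero, cesaroMean_sub_apply]
  change q.1 _ ≤ _
  rw [map_smul_eq_mul, norm_inv, Complex.norm_natCast]
  gcongr
  exact (map_sub_le_add q.1 _ _).trans (by gcongr; exact h n x)

/-- Equicontinuity of the means makes the set of points where they tend to `0` closed, and
telescoping puts the range of `1 - T` inside it. -/
theorem IsPowerBounded.tendsto_cesaroMean_of_mem_closure (hT : IsPowerBounded T) {x : E}
    (hx : x ∈ closure (LinearMap.range ((1 - T : E →L[ℂ] E) : E →ₗ[ℂ] E) : Set E)) :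
    Tendsto (fun n => cesaroMean T n x) atTop (𝓝 0) := by
  have hcl := hT.equicontinuous_cesaroMean.isClosed_setOfPred_tendsto (l := atTop)
    (f := fun _ => (0 : E)) continuous_const
  refine closure_minimal ?_ hcl hx
  rintro _ ⟨y, rfl⟩
  exact hT.tendsto_cesaroMean_sub y

theorem IsPowerBounded.isVonNBounded_range_cesaroMean (hT : IsPowerBounded T) (x : E) :
    Bornology.IsVonNBounded ℂ (Set.range fun n => cesaroMean T n x) := by
  rw [(PolynormableSpace.withSeminorms ℂ E).isVonNBounded_iff_seminorm_bounded]
  intro q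
  obtain ⟨p, hp, h⟩ := hT.exists_seminorm q.2
  refine ⟨p x + 1, by positivity, ?_⟩
  rintro _ ⟨n, rfl⟩
  exact (seminorm_cesaroMean_le h n x).trans_lt (lt_add_one _)

variable [T2Space E]

/-- **Yosida's mean ergodic theorem** for operators with relatively compact Cesàro orbits. -/
theorem IsPowerBounded.exists_tendsto_cesaroMean (hT : IsPowerBounded T) {x : E} {K : Set E}
    (hK : IsCompact K) (hxK : ∀ n, cesaroMean T n x ∈ K) :
    ∃ y, Tendsto (fun n => cesaroMean T n x) atTop (𝓝 y) := by
  obtain ⟨y, -, hy⟩ := hK.exists_mapClusterPt (f := atTop) (u := fun n => cesaroMean T n x)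
    (by simpa using! ⟨0, fun n _ => hxK n⟩)
  obtain ⟨U, hU, hUy⟩ := mapClusterPt_iff_ultrafilter.mp hy
  have hfix : T y = y := by
    have h1 : Tendsto (fun n => cesaroMean T n x - T (cesaroMean T n x)) U (𝓝 (y - T y)) :=
      hUy.sub ((T.continuous.tendsto y).comp hUy)
    have h2 : Tendsto (fun n => cesaroMean T n x - T (cesaroMean T n x)) U (𝓝 0) := by
      simp_rw [cesaroMean_comm, ← map_sub]
      exact (hT.tendsto_cesaroMean_sub x).mono_left hU
    exact (sub_eq_zero.mp (tendsto_nhds_unique h1 h2)).symm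
  -- Each `x - cesaroMean T n x` with `n ≠ 0` lies in the range of `1 - T`, and `x - y` is their
  -- limit along `U`. So `x` splits into the fixed vector `y` and a part whose means vanish in the
  -- limit.
  have hmem : x - y ∈ closure
      (LinearMap.range ((1 - T : E →L[ℂ] E) : E →ₗ[ℂ] E) : Set E) :=
    mem_closure_of_tendsto (tendsto_const_nhds.sub hUy)
      (((eventually_ne_atTop 0).filter_mono hU).mono fun n hn => sub_cesaroMean_mem_range T hn x)
  refine ⟨y, ?_⟩
  have h := (hT.tendsto_cesaroMean_of_mem_closure hmem).add_const y
  rw [zero_add] at h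
  refine h.congr' ?_
  filter_upwards [eventually_ne_atTop 0] with n hn
  rw [map_sub, cesaroMean_apply_of_fixed hfix hn, sub_add_cancel]

/-- On a Hausdorff locally convex space whose bounded sets are relatively compact, every power
bounded operator is uniformly mean ergodic. -/
theorem IsPowerBounded.isUniformlyMeanErgodic (hT : IsPowerBounded T)
    (hE : ∀ B : Set E, Bornology.IsVonNBounded ℂ B → ∃ K, IsCompact K ∧ B ⊆ K) :
    IsUniformlyMeanErgodic T := by
  have hlim : ∀ x, ∃ y, Tendsto (fun n => cesaroMean T n x) atTop (𝓝 y) := fun x => by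
    obtain ⟨K, hK, hsub⟩ := hE _ (hT.isVonNBounded_range_cesaroMean x)
    exact hT.exists_tendsto_cesaroMean hK fun n => hsub ⟨n, rfl⟩
  choose f hf using hlim
  have heq := hT.equicontinuous_cesaroMean
  have hpi : Tendsto (fun (n : ℕ) (x : E) => cesaroMean T n x) atTop (𝓝 f) :=
    tendsto_pi_nhds.mpr hf
  let S : E →L[ℂ] E :=
    { toLinearMap := linearMapOfTendsto f (fun n => (cesaroMean T n : E →ₗ[ℂ] E)) hpi
      cont := hpi.continuous_of_equicontinuous heq }
  refine ⟨S, ?_⟩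
  refine (UniformConvergenceCLM.tendsto_iff_tendstoUniformlyOn (RingHom.id ℂ) E
    {B : Set E | Bornology.IsVonNBounded ℂ B}).mpr fun B hB => ?_
  obtain ⟨K, hK, hBK⟩ := hE B hB
  -- For equicontinuous families, pointwise convergence is uniform on compact sets.
  have h := (EquicontinuousOn.tendsto_uniformOnFun_iff_pi (𝔖 := {K : Set E | IsCompact K})
    (fun _ => id) (Set.eq_univ_iff_forall.mpr fun x =>
      Set.mem_sUnion_of_mem (Set.mem_singleton x) isCompact_singleton)
    (fun K _ => heq.equicontinuousOn K) atTop f).mpr hpi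
  exact (UniformOnFun.tendsto_iff_tendstoUniformlyOn.mp h K hK).mono hBK

end MeanErgodic

/-! ### Polarization of homogeneous polynomials -/

section Polarization

variable {m : ℕ} {X : Type*} [AddCommGroup X] [Module ℂ X]

/-- The polarization of a function `f`, which for `f x = L (x, …, x)` with `L` an `m`-linear form
is the symmetrization of `L`. -/
noncomputable def polarization (m : ℕ) (f : X → ℂ) (x : Fin m → X) : ℂ :=
  (m.factorial : ℂ)⁻¹ * ∑ s : Finset (Fin m), (-1) ^ s.card * f (∑ i ∈ sᶜ, x i)

/-- Inclusion–exclusion: in the expansion over index maps `r`, the signs of the sets `s` disjoint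
from the image of `r` cancel unless that image is everything, so only permutations survive. -/
theorem polarization_eq_sum_perm (L : MultilinearMap ℂ (fun _ : Fin m => X) ℂ) (x : Fin m → X) :
    polarization m (fun y => L fun _ => y) x =
      (m.factorial : ℂ)⁻¹ * ∑ σ : Equiv.Perm (Fin m), L fun i => x (σ i) := by
  classical
  unfold polarization
  congr 1
  have h1 : ∀ s : Finset (Fin m), (-1 : ℂ) ^ s.card * (L fun _ => ∑ i ∈ sᶜ, x i) =
      ∑ r : Fin m → Fin m, if s ⊆ (Finset.univ.image r)ᶜ then
        (-1 : ℂ) ^ s.card * L (fun i => x (r i)) else 0 := by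
    intro s
    rw [L.map_sum_finset (fun _ j => x j) (fun _ => sᶜ), Finset.mul_sum, ← Finset.sum_filter]
    refine Finset.sum_congr ?_ fun _ _ => rfl
    ext r
    simp only [Fintype.mem_piFinset, Finset.mem_compl, Finset.mem_filter, Finset.mem_univ,
      true_and, Finset.subset_iff, Finset.mem_image, not_exists]
    exact ⟨fun h a ha i hi => h i (hi ▸ ha), fun h i hi => h hi i rfl⟩
  have h2 : ∀ r : Fin m → Fin m, (∑ s : Finset (Fin m), if s ⊆ (Finset.univ.image r)ᶜ then
        (-1 : ℂ) ^ s.card * L (fun i => x (r i)) else 0) =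
      if Function.Bijective r then L (fun i => x (r i)) else 0 := by
    intro r
    have h3 := congrArg (Int.cast : ℤ → ℂ)
      (Finset.sum_powerset_neg_one_pow_card (x := (Finset.univ.image r)ᶜ))
    push_cast at h3
    have h4 : Finset.univ.filter (fun s => s ⊆ (Finset.univ.image r)ᶜ) =
        ((Finset.univ.image r)ᶜ).powerset := by
      ext; simp
    rw [← Finset.sum_filter, ← Finset.sum_mul, h4, h3]
    have h5 : (Finset.univ.image r)ᶜ = ∅ ↔ Function.Bijective r := by
      rw [Finset.compl_eq_empty_iff, ← Finite.surjective_iff_bijective]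
      simp [Finset.eq_univ_iff_forall, Function.Surjective]
    simp [h5]
  rw [Finset.sum_congr rfl fun s _ => h1 s, Finset.sum_comm, Finset.sum_congr rfl fun r _ => h2 r,
    ← Finset.sum_filter]
  symm
  refine Finset.sum_bij (fun (σ : Equiv.Perm (Fin m)) _ => (σ : Fin m → Fin m)) ?_ ?_ ?_ ?_
  · intro σ _
    exact Finset.mem_filter.mpr ⟨Finset.mem_univ _, σ.bijective⟩
  · intro σ _ τ _ h
    exact DFunLike.coe_injective h
  · intro r hr
    exact ⟨Equiv.ofBijective r ((Finset.mem_filter.mp hr).2), Finset.mem_univ _, rfl⟩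
  · intro σ _
    rfl

theorem polarization_diag (L : MultilinearMap ℂ (fun _ : Fin m => X) ℂ) (x : X) :
    polarization m (fun y => L fun _ => y) (fun _ => x) = L fun _ => x := by
  rw [polarization_eq_sum_perm, Finset.sum_const, Finset.card_univ, Fintype.card_perm,
    Fintype.card_fin, nsmul_eq_mul, ← mul_assoc,
    inv_mul_cancel₀ (by exact_mod_cast m.factorial_ne_zero), one_mul]

theorem exists_multilinearMap_eq_polarization (L : MultilinearMap ℂ (fun _ : Fin m => X) ℂ) :
    ∃ M : MultilinearMap ℂ (fun _ : Fin m => X) ℂ,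
      ∀ x, M x = polarization m (fun y => L fun _ => y) x := by
  refine ⟨(m.factorial : ℂ)⁻¹ • ∑ σ : Equiv.Perm (Fin m), L.domDomCongr σ, fun x => ?_⟩
  simp [polarization_eq_sum_perm]

omit [Module ℂ X] in
theorem continuous_polarization_left (x : Fin m → X) :
    Continuous fun f : X → ℂ => polarization m f x := by
  unfold polarization
  fun_prop

end Polarization

theorem exists_norm_le_of_isVonNBounded {E : Type*} [AddCommGroup E] [Module ℂ E]
    [TopologicalSpace E] {B : Set E} (hB : Bornology.IsVonNBounded ℂ B) (f : E →L[ℂ] ℂ) :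
    ∃ C, ∀ p ∈ B, ‖f p‖ ≤ C := by
  have hbdd : Bornology.IsBounded (f '' B) :=
    (NormedSpace.isVonNBounded_iff ℂ).mp (hB.image f)
  obtain ⟨C, hC⟩ := hbdd.exists_norm_le
  exact ⟨C, fun p hp => hC _ ⟨p, hp, rfl⟩⟩

/-! ### Bounded sets of homogeneous polynomials -/

namespace HomPoly

variable {m : ℕ} {X : Type*} [NormedAddCommGroup X] [NormedSpace ℂ X]

theorem map_smul_arg (p : HomPoly m X) (c : ℂ) (x : X) : p.1 (c • x) = c ^ m * p.1 x := by
  obtain ⟨L, hL⟩ := p.2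
  rw [hL, hL]
  simpa using L.map_smul_univ (fun _ => c) (fun _ => x)

theorem differentiable (p : HomPoly m X) : Differentiable ℂ p.1 := by
  obtain ⟨L, hL⟩ := p.2
  rw [show (p.1 : X → ℂ) = fun x => L fun _ => x from funext hL]
  exact (L.contDiff (n := 1)).differentiable (by simp) |>.comp (by fun_prop)

/-- A bound on a ball carries over to the ball of the same radius around the origin. -/
theorem norm_le_of_forall_mem_closedBall {p : HomPoly m X} {a : X} {r C : ℝ}
    (h : ∀ x ∈ Metric.closedBall a r, ‖p.1 x‖ ≤ C) {y : X} (hy : ‖y‖ ≤ r) : ‖p.1 y‖ ≤ C := by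
  have hd : Differentiable ℂ fun ζ : ℂ => p.1 (ζ • a + y) :=
    (differentiable p).comp (by fun_prop)
  -- Maximum principle for `ζ ↦ p (ζ • a + y)` on the unit disc: the centre gives `p y`, and on the
  -- circle homogeneity moves the argument to `a + ζ⁻¹ • y`, inside the given ball.
  have := Complex.norm_le_of_forall_mem_frontier_norm_le (Metric.isBounded_ball (x := (0 : ℂ))
    (r := 1)) hd.diffContOnCl (C := C) (z := 0) (fun ζ hζ => ?_)
    (subset_closure (Metric.mem_ball_self one_pos))
  · simpa using this
  rw [frontier_ball _ one_ne_zero, mem_sphere_zero_iff_norm] at hζ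
  have hζ0 : ζ ≠ 0 := norm_ne_zero_iff.mp (by simp [hζ])
  have : ζ • a + y = ζ • (a + ζ⁻¹ • y) := by rw [smul_add, smul_inv_smul₀ hζ0]
  rw [this, map_smul_arg, norm_mul, norm_pow, hζ, one_pow, one_mul]
  exact h _ (by simpa [norm_smul, hζ] using hy)

theorem norm_le_of_forall_norm_le {p : HomPoly m X} {r C : ℝ} (hr : 0 < r)
    (h : ∀ x : X, ‖x‖ ≤ r → ‖p.1 x‖ ≤ C) (x : X) : ‖p.1 x‖ ≤ C / r ^ m * ‖x‖ ^ m := by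
  rcases eq_or_ne x 0 with rfl | hx
  · rcases eq_or_ne m 0 with rfl | hm
    · simpa using h 0 (by simpa using hr.le)
    · have := map_smul_arg p 0 0
      simp only [zero_smul, zero_pow hm, zero_mul] at this
      simp [this, hm]
  have hx' : 0 < ‖x‖ := norm_pos_iff.mpr hx
  have h1 := h (((r / ‖x‖ : ℝ) : ℂ) • x) (by
    rw [norm_smul, Complex.norm_real, norm_div, norm_norm, Real.norm_of_nonneg hr.le,
      div_mul_cancel₀ _ hx'.ne'])
  rw [map_smul_arg, norm_mul, norm_pow, Complex.norm_real, norm_div, norm_norm,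
    Real.norm_of_nonneg hr.le, div_pow] at h1
  have h2 : 0 < r ^ m := by positivity
  have h3 : 0 < ‖x‖ ^ m := by positivity
  rw [div_mul_eq_mul_div, div_le_iff₀ h3] at h1
  rw [div_mul_eq_mul_div]
  rw [le_div_iff₀ h2]
  linarith

/-- **Banach–Steinhaus theorem** for homogeneous polynomials. -/
theorem exists_forall_norm_le [CompleteSpace X] {B : Set (HomPoly m X)}
    (hB : ∀ x : X, ∃ C, ∀ p ∈ B, ‖p.1 x‖ ≤ C) :
    ∃ C, ∀ p ∈ B, ∀ x, ‖p.1 x‖ ≤ C * ‖x‖ ^ m := by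
  let F : ℕ → Set X := fun n => ⋂ p ∈ B, {x | ‖p.1 x‖ ≤ n}
  have hF : ∀ n, IsClosed (F n) := fun n =>
    isClosed_biInter fun p _ => isClosed_le (p.1.continuous.norm) continuous_const
  have hU : ⋃ n, F n = Set.univ := by
    refine Set.eq_univ_iff_forall.mpr fun x => ?_
    obtain ⟨C, hC⟩ := hB x
    obtain ⟨n, hn⟩ := exists_nat_ge C
    exact Set.mem_iUnion.mpr ⟨n, Set.mem_iInter₂.mpr fun p hp => (hC p hp).trans hn⟩
  obtain ⟨n, a, ha⟩ := nonempty_interior_of_iUnion_of_closed hF hU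
  obtain ⟨r, hr, hsub⟩ := Metric.nhds_basis_closedBall.mem_iff.mp (mem_interior_iff_mem_nhds.mp ha)
  refine ⟨n / r ^ m, fun p hp x => norm_le_of_forall_norm_le hr (fun y hy => ?_) x⟩
  exact norm_le_of_forall_mem_closedBall (fun z hz => Set.mem_iInter₂.mp (hsub hz) p hp) hy

/-- The functions given by the homogeneous polynomials with norm at most `C`. -/
def boundedFunctions (m : ℕ) (X : Type*) [NormedAddCommGroup X] [NormedSpace ℂ X] (C : ℝ) :
    Set (X → ℂ) :=
  {f | (∃ p : HomPoly m X, f = p.1) ∧ ∀ x, ‖f x‖ ≤ C * ‖x‖ ^ m}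

/-- On the unit ball around `a` all these functions are bounded by one `M`, so the Schwarz lemma
gives them the common Lipschitz constant `2 * M` at `a`. -/
theorem equicontinuous_boundedFunctions (C : ℝ) : (boundedFunctions m X C).Equicontinuous := by
  intro a
  set M := |C| * (‖a‖ + 1) ^ m
  have hM : ∀ f ∈ boundedFunctions m X C, ∀ x ∈ Metric.ball a 1, ‖f x‖ ≤ M := by
    intro f hf x hx
    have : ‖x‖ ≤ ‖a‖ + 1 := by
      have h1 := norm_sub_norm_le x a
      have h2 := mem_ball_iff_norm.mp hx
      linarith
    calc ‖f x‖ ≤ C * ‖x‖ ^ m := hf.2 x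
      _ ≤ |C| * (‖a‖ + 1) ^ m := by gcongr; exact le_abs_self C
  refine Metric.equicontinuousAt_of_continuity_modulus (fun x => 2 * M / 1 * dist x a) ?_ _ ?_
  · have : Continuous fun x => 2 * M / 1 * dist x a := by fun_prop
    simpa using this.tendsto a
  filter_upwards [Metric.ball_mem_nhds a one_pos] with x hx
  rintro ⟨f, hf⟩
  obtain ⟨p, hp⟩ := hf.1
  have hd : Differentiable ℂ f := hp ▸ (differentiable p)
  rw [dist_comm]
  refine Complex.dist_le_div_mul_dist_of_mapsTo_ball hd.differentiableOn (fun y hy => ?_) hx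
  rw [mem_closedBall_iff_norm]
  have h1 := hM f hf y hy
  have h2 := hM f hf a (Metric.mem_ball_self one_pos)
  linarith [norm_sub_le (f y) (f a)]

/-- A pointwise limit `f` comes with no multilinear form, but its polarization is one:
multilinearity and agreement with `f` on the diagonal are equations between finitely many values of
`f`, so they pass to the limit. Continuity of `f` comes from equicontinuity. -/
theorem isClosed_boundedFunctions (C : ℝ) : IsClosed (boundedFunctions m X C) := by
  classical
  refine isClosed_of_closure_subset fun f hf => ?_
  have hcont : Continuous f := (equicontinuous_boundedFunctions C).closure.continuous_of_mem hf
  have hmem : ∀ {s : Set (X → ℂ)}, IsClosed s → boundedFunctions m X C ⊆ s → f ∈ s :=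
    fun hs h => closure_minimal h hs hf
  have key : ∀ g ∈ boundedFunctions m X C,
      ∃ L : MultilinearMap ℂ (fun _ : Fin m => X) ℂ, g = fun x => L fun _ => x := by
    rintro g ⟨⟨p, rfl⟩, -⟩
    obtain ⟨L, hL⟩ := p.2
    exact ⟨L.toMultilinearMap, funext hL⟩
  have hc := fun x : Fin m → X => continuous_polarization_left x
  have hadd : ∀ (x : Fin m → X) i a b, polarization m f (Function.update x i (a + b)) =
      polarization m f (Function.update x i a) + polarization m f (Function.update x i b) := by
    intro x i a b
    refine hmem (s := {f | polarization m f (Function.update x i (a + b)) =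
      polarization m f (Function.update x i a) + polarization m f (Function.update x i b)})
      (isClosed_eq (hc _) ((hc _).add (hc _))) fun g hg => ?_
    obtain ⟨L, rfl⟩ := key g hg
    obtain ⟨M, hM⟩ := exists_multilinearMap_eq_polarization L
    simp only [Set.mem_ofPred_eq, ← hM, M.map_update_add]
  have hsmul : ∀ (x : Fin m → X) i (c : ℂ) a, polarization m f (Function.update x i (c • a)) =
      c • polarization m f (Function.update x i a) := by
    intro x i c a
    refine hmem (s := {f | polarization m f (Function.update x i (c • a)) =
      c • polarization m f (Function.update x i a)})
      (isClosed_eq (hc _) ((hc _).const_smul c)) fun g hg => ?_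
    obtain ⟨L, rfl⟩ := key g hg
    obtain ⟨M, hM⟩ := exists_multilinearMap_eq_polarization L
    simp only [Set.mem_ofPred_eq, ← hM, M.map_update_smul]
  have hdiag : ∀ x : X, polarization m f (fun _ => x) = f x := by
    intro x
    refine hmem (s := {f | polarization m f (fun _ => x) = f x})
      (isClosed_eq (hc _) (continuous_apply x)) fun g hg => ?_
    obtain ⟨L, rfl⟩ := key g hg
    exact polarization_diag L x
  refine ⟨⟨⟨⟨f, hcont⟩, ⟨⟨⟨polarization m f, ?_, ?_⟩, ?_⟩, fun x => (hdiag x).symm⟩⟩, rfl⟩,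
    fun x => ?_⟩
  · intro _ x i a b
    convert hadd x i a b
  · intro _ x i c a
    convert hsmul x i c a
  · change Continuous (polarization m f)
    unfold polarization
    fun_prop
  · exact hmem (s := {f | ‖f x‖ ≤ C * ‖x‖ ^ m})
      (isClosed_le (continuous_apply x).norm continuous_const) fun g hg => hg.2 x

theorem isCompact_boundedFunctions (C : ℝ) : IsCompact (boundedFunctions m X C) := by
  refine (isCompact_univ_pi fun x : X =>
    isCompact_closedBall (0 : ℂ) (C * ‖x‖ ^ m)).of_isClosed_subset
    (isClosed_boundedFunctions C) fun f hf x _ => ?_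
  simpa using hf.2 x

theorem isCompact_setOf_norm_le (C : ℝ) :
    IsCompact {p : HomPoly m X | ∀ x, ‖p.1 x‖ ≤ C * ‖x‖ ^ m} := by
  rw [Topology.IsEmbedding.subtypeVal.isCompact_iff]
  have himg : ContinuousMap.toFun '' (Subtype.val '' {p : HomPoly m X |
      ∀ x, ‖p.1 x‖ ≤ C * ‖x‖ ^ m}) = boundedFunctions m X C := by
    ext f
    constructor
    · rintro ⟨_, ⟨p, hp, rfl⟩, rfl⟩
      exact ⟨⟨p, rfl⟩, hp⟩
    · rintro ⟨⟨p, rfl⟩, hp⟩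
      exact ⟨p.1, ⟨p, hp, rfl⟩, rfl⟩
  -- Ascoli lifts compactness from the pointwise to the compact-open topology.
  refine ArzelaAscoli.isCompact_of_equicontinuous _ (himg ▸ isCompact_boundedFunctions C) ?_
  refine Equicontinuous.comp (equicontinuous_boundedFunctions (m := m) (X := X) C)
    fun g : (Subtype.val '' {p : HomPoly m X | ∀ x, ‖p.1 x‖ ≤ C * ‖x‖ ^ m} : Set C(X, ℂ)) =>
      ⟨g.1, ?_⟩
  rw [← himg]
  exact ⟨g.1, g.2, rfl⟩

/-- Evaluation at a point, as a continuous linear form on `𝒫(ᵐX)_{τ₀}`. -/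
noncomputable def evalCLM (m : ℕ) (x : X) : HomPoly m X →L[ℂ] ℂ where
  toFun p := p.1 x
  map_add' _ _ := rfl
  map_smul' _ _ := rfl
  cont := (continuous_eval_const x).comp continuous_subtype_val

/-- `𝒫(ᵐX)_{τ₀}` is a semi-Montel space. -/
theorem exists_isCompact_of_isVonNBounded [CompleteSpace X] {B : Set (HomPoly m X)}
    (hB : Bornology.IsVonNBounded ℂ B) : ∃ K, IsCompact K ∧ B ⊆ K := by
  have hpt : ∀ x : X, ∃ C, ∀ p ∈ B, ‖p.1 x‖ ≤ C := fun x =>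
    exists_norm_le_of_isVonNBounded (E := HomPoly m X) hB (evalCLM m x)
  obtain ⟨C, hC⟩ := exists_forall_norm_le hpt
  exact ⟨_, isCompact_setOf_norm_le C, hC⟩

open scoped ComplexOrder in
instance instPolynormableSpace : PolynormableSpace ℂ (HomPoly m X) :=
  -- Convexity over `ℂ` involves only nonnegative scalars, which are real in this order, so real
  -- convexity of balls is enough.
  have : LocallyConvexSpace ℂ ℂ := 
    .ofBasisZero ℂ ℂ _ _ Metric.nhds_basis_ball fun r _ =>
      convex_of_nonneg_surjective_algebraMap _
        (fun _ h => RCLike.nonneg_iff_exists_ofReal.mp h) (convex_ball 0 r)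
  have : PolynormableSpace ℂ C(X, ℂ) := LocallyConvexSpace.toPolynormableSpace
  inferInstance

end HomPoly

theorem corollary3p2 (m : ℕ) {X : Type*} [NormedAddCommGroup X] [NormedSpace ℂ X]
    [CompleteSpace X] (φ : X →L[ℂ] X)
    (hφ : IsPowerBounded (E := HomPoly m X) (compOp m φ)) :
    IsUniformlyMeanErgodic (E := HomPoly m X) (compOp m φ) :=
  hφ.isUniformlyMeanErgodic fun _ => HomPoly.exists_isCompact_of_isVonNBounded
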